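/- Let $G$ be a finite simple graph. In the domatic game on $G$ with palette size $k\ge 1$, Alice and Bob alternately choose an uncolored vertex of $G$ and color it with a color from $\{1,\dots,k\}$ until all vertices are colored. Alice wins if for every color $i$ the set of vertices colored $i$ is a dominating set of $G$ (every vertex is in the set or adjacent to a member of it); otherwise Bob wins. For $X\in\{A,B\}$ (Alice, Bob), let $\mathrm{dom}_g(G,X)$ be the largest $k$ such that Alice has a winning strategy with palette size $k$ when player $X$ moves first. Let $\delta(G)$ denote the minimum degree of $G$ and $\log$ the natural logarithm. **Theorem.** 1. There is an absolute constant $c>0$ such that for every graph $G$ on $n\ge 2$ vertices and each $X\in\{A,B\}$, $$\mathrm{dom}_g(G,X)\ \ge\ c\cdot\frac{\delta(G)}{\log n}.$$ Moreover, there is an $n_0$ such that for all graphs on $n\ge \max(n_0,2)$ vertices the inequality holds with $c=\frac1{100}$. 2. There are bipartite graphs $G_n$ ($n\ge 1$), where $G_n$ has $n$ vertices, such that $\mathrm{dom}_g(G_n,X)=1$ for all $n\ge1$ and both $X\in\{A,B\}$, and $\delta(G_n)=\Theta(\log n)$ as $n\to\infty$. -/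

import Mathlib

open Filter Asymptotics

universe u

namespace DomaticGame

/-- The two players. -/
inductive Player
  | alice
  | bob

/-- `S` is a dominating set of `G`: every vertex is in `S` or adjacent to a member of `S`. -/
def IsDominating {V : Type*} (G : SimpleGraph V) (S : Set V) : Prop :=
  ∀ v, v ∈ S ∨ ∃ w ∈ S, G.Adj v w

/-- A position of the game with palette size `k`: a partial coloring of the vertices
with colors from a `k`-element set; `none` means uncolored. -/
abbrev Position (V : Type*) (k : ℕ) : Type _ := V → Option (Fin k)

/-- The position after the vertex `v` receives the color `i`. -/
noncomputable def Position.play {V : Type*} {k : ℕ} (p : Position V k) (v : V) (i : Fin k) :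
    Position V k :=
  open scoped Classical in Function.update p v (some i)

/-- `AliceWinsFrom G k X p`: in the domatic game on `G` with palette size `k`, Alice can force
a win from the position `p` when it is player `X`'s turn. In a finished game every color class
must be dominating; on her turn Alice needs one good move; on Bob's turn every
move of Bob must be good for Alice. -/
inductive AliceWinsFrom {V : Type*} (G : SimpleGraph V) (k : ℕ) :
    Player → Position V k → Prop
  | finished (X : Player) (p : Position V k) (full : ∀ v, p v ≠ none)
      (dom : ∀ i : Fin k, IsDominating G {v | p v = some i}) : AliceWinsFrom G k X p
  | aliceMove (p : Position V k) (v : V) (i : Fin k) (hv : p v = none)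
      (next : AliceWinsFrom G k Player.bob (p.play v i)) : AliceWinsFrom G k Player.alice p
  | bobMove (p : Position V k) (unfinished : ∃ v, p v = none)
      (next : ∀ (v : V) (i : Fin k), p v = none →
        AliceWinsFrom G k Player.alice (p.play v i)) : AliceWinsFrom G k Player.bob p

/-- Alice wins the domatic game on `G` with palette size `k` when player `X` moves first. -/
def AliceWins {V : Type*} (G : SimpleGraph V) (X : Player) (k : ℕ) : Prop :=
  AliceWinsFrom G k X (fun _ => none)

/-- The domatic game number `dom_g(G, X)`: the largest (positive) palette size with which Alice
wins when player `X` moves first. The maximum exists for every finite nonempty graph, see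
`isGreatest_domaticGameNumber`. -/
noncomputable def domaticGameNumber {V : Type*} (G : SimpleGraph V) (X : Player) : ℕ :=
  sSup {k : ℕ | 1 ≤ k ∧ AliceWins G X k}

theorem AliceWinsFrom.exists_coloring {V : Type*} {G : SimpleGraph V} {k : ℕ} (hk : 1 ≤ k)
    {X : Player} {p : Position V k} (h : AliceWinsFrom G k X p) :
    ∃ q : Position V k, ∀ i : Fin k, IsDominating G {v | q v = some i} := by
  induction h with
  | finished X p full dom => exact ⟨p, dom⟩
  | aliceMove p v i hv next ih => exact ih
  | bobMove p unfinished next ih =>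
    obtain ⟨v, hv⟩ := unfinished
    exact ih v ⟨0, hk⟩ hv

theorem AliceWins.le_card {V : Type*} [Fintype V] [Nonempty V] {G : SimpleGraph V}
    {X : Player} {k : ℕ} (hk : 1 ≤ k) (h : AliceWins G X k) : k ≤ Fintype.card V := by
  obtain ⟨q, hq⟩ := AliceWinsFrom.exists_coloring hk h
  have hne : ∀ i : Fin k, ∃ v, q v = some i := fun i => by
    rcases hq i (Classical.arbitrary V) with h | ⟨w, h, -⟩
    · exact ⟨_, h⟩
    · exact ⟨w, h⟩
  choose f hf using hne
  have hinj : Function.Injective f := fun i j hij => by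
    have h := hf i
    rw [hij, hf j] at h
    exact (Option.some.inj h).symm
  simpa using Fintype.card_le_of_injective f hinj

theorem aliceWinsFrom_one {V : Type*} [Fintype V] (G : SimpleGraph V) (m : ℕ) :
    ∀ (X : Player) (p : Position V 1), {v | p v = none}.ncard = m → AliceWinsFrom G 1 X p := by
  induction m with
  | zero =>
    intro X p hp
    rw [Set.ncard_eq_zero (Set.toFinite _)] at hp
    have full : ∀ v, p v ≠ none := fun v hv => by
      have : v ∈ {v | p v = none} := hv
      simp [hp] at this
    refine .finished X p full fun i v => Or.inl ?_
    obtain ⟨j, hj⟩ := Option.ne_none_iff_exists'.1 (full v)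
    simp [hj, Subsingleton.elim j i]
  | succ m ih =>
    intro X p hp
    have step : ∀ (Y : Player) (v : V) (i : Fin 1), p v = none →
        AliceWinsFrom G 1 Y (p.play v i) := fun Y v i hv => by
      refine ih Y _ ?_
      have : {w | p.play v i w = none} = {w | p w = none} \ {v} := by
        ext w
        by_cases hw : w = v <;> simp [Position.play, Function.update_apply, hw]
      have hv' : v ∈ {w | p w = none} := hv
      rw [this, Set.ncard_sdiff_singleton_of_mem hv', hp]
      rfl
    have hex : ∃ v, p v = none := by
      have h : {v | p v = none}.ncard ≠ 0 := by omega
      exact Set.nonempty_of_ncard_ne_zero h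
    cases X with
    | alice =>
      obtain ⟨v, hv⟩ := hex
      exact .aliceMove p v 0 hv (step _ v 0 hv)
    | bob => exact .bobMove p hex fun v i hv => step _ v i hv

theorem isGreatest_domaticGameNumber {V : Type*} [Fintype V] [Nonempty V]
    (G : SimpleGraph V) (X : Player) :
    IsGreatest {k : ℕ | 1 ≤ k ∧ AliceWins G X k} (domaticGameNumber G X) := by
  have hb : BddAbove {k : ℕ | 1 ≤ k ∧ AliceWins G X k} :=
    ⟨Fintype.card V, fun k hk => hk.2.le_card hk.1⟩
  exact ⟨Nat.sSup_mem ⟨1, le_rfl, aliceWinsFrom_one G _ X _ rfl⟩ hb, fun k hk => le_csSup hb hk⟩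

end DomaticGame

/-! Lower bound: a derandomized random coloring. With `R = 1 + 1/(2k)`, each pair of a vertex and a
color missing from its closed neighborhood has danger `R⁻¹ ^ m`, where `m` counts the uncolored
vertices there. Alice colors the vertex with the greatest danger around it, in the color carrying at
least a `1/k` share. This pays for any reply of Bob (`exists_good_move`), so the total danger never
grows over a round. In a full coloring each missing pair has danger `1`, so Alice wins whenever the
total starts below `1`. This gives the criterion `n * k < R ^ δ` of `aliceWins_of_lt_pow`, which
holds for `k` of order `δ / log n`.

Upper bound: Bob secures one color in each of many disjoint pairs (`not_aliceWins_of_pairing`). In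
`digitGraph`, `t` pairs stand for binary digits and each `t`-bit string has its own pair of
vertices, adjacent to the digit vertices it selects. Bob's vertices in the digit pairs spell some
`F`, and his vertex in the pair of `F` then has a closed neighborhood of one color. About `2 ^ t`
strings suffice to produce degrees of order `t`, hence of order `log n`. -/

namespace DomaticGame

open Finset

/-! ### Alice's strategy: the potential function -/

section Potential

variable {V : Type*} {k : ℕ}

open scoped Classical in
/-- The danger of color `i` at the set `E v`: zero once the color occurs there, and otherwise
exponentially small in the number of uncolored vertices of `E v`. -/
noncomputable def pairWeight (E : V → Finset V) (R : ℝ) (p : Position V k) (v : V) (i : Fin k) : ℝ :=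
  if ∃ w ∈ E v, p w = some i then 0 else R⁻¹ ^ #{w ∈ E v | p w = none}

theorem Position.play_self (p : Position V k) (w : V) (i : Fin k) : p.play w i w = some i := by
  simp [Position.play]

theorem Position.play_of_ne (p : Position V k) {v w : V} (i : Fin k) (h : v ≠ w) :
    p.play w i v = p v := by
  simp [Position.play, h]

theorem pairWeight_nonneg (E : V → Finset V) {R : ℝ} (hR : 1 ≤ R) (p : Position V k) (v : V)
    (i : Fin k) : 0 ≤ pairWeight E R p v i := by
  unfold pairWeight
  split_ifs
  · exact le_rfl
  · positivity

theorem pairWeight_play_of_notMem {E : V → Finset V} {R : ℝ} {p : Position V k} {v w : V}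
    (i j : Fin k) (h : w ∉ E v) : pairWeight E R (p.play w i) v j = pairWeight E R p v j := by
  have key : ∀ x ∈ E v, p.play w i x = p x := fun x hx =>
    p.play_of_ne i fun e => h (e ▸ hx)
  have h₁ : (∃ x ∈ E v, p.play w i x = some j) ↔ ∃ x ∈ E v, p x = some j :=
    exists_congr fun x => and_congr_right fun hx => by rw [key x hx]
  unfold pairWeight
  simp only [h₁]
  congr 3
  exact filter_congr fun x hx => by rw [key x hx]

theorem pairWeight_play_eq_zero {E : V → Finset V} {R : ℝ} {p : Position V k} {v w : V}
    (i : Fin k) (h : w ∈ E v) : pairWeight E R (p.play w i) v i = 0 :=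
  if_pos ⟨w, h, p.play_self w i⟩

/-- A move uses up at most one uncolored vertex of `E v`, which costs one factor `R`. -/
theorem pairWeight_play_le {E : V → Finset V} {R : ℝ} (hR : 1 ≤ R) {p : Position V k} {w : V}
    (hw : p w = none) (v : V) (i j : Fin k) :
    pairWeight E R (p.play w i) v j ≤ R * pairWeight E R p v j := by
  classical
  by_cases h : ∃ x ∈ E v, p.play w i x = some j
  · rw [pairWeight, if_pos h]
    exact mul_nonneg (by linarith) (pairWeight_nonneg E hR p v j)
  have h' : ¬ ∃ x ∈ E v, p x = some j := by
    rintro ⟨x, hx, hxj⟩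
    refine h ⟨x, hx, ?_⟩
    rwa [p.play_of_ne]
    rintro rfl
    simp [hw] at hxj
  rw [pairWeight, if_neg h, pairWeight, if_neg h']
  have hc : #{x ∈ E v | p x = none} ≤ #{x ∈ E v | p.play w i x = none} + 1 := by
    refine (card_le_card (t := insert w {x ∈ E v | p.play w i x = none}) fun x hx => ?_).trans
      (card_insert_le _ _)
    rw [mem_filter] at hx
    by_cases hxw : x = w
    · simp [hxw]
    · simp [hx, p.play_of_ne i hxw]
  have h0 : 0 < R := by linarith
  calc R⁻¹ ^ #{x ∈ E v | p.play w i x = none}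
      = R * R⁻¹ ^ (#{x ∈ E v | p.play w i x = none} + 1) := by
        rw [pow_succ]; field_simp
    _ ≤ _ := by
        refine mul_le_mul_of_nonneg_left ?_ h0.le
        exact pow_le_pow_of_le_one (by positivity) (inv_le_one_of_one_le₀ hR) hc

variable [Fintype V]

/-- The total danger of a position. -/
noncomputable def potential (E : V → Finset V) (R : ℝ) (p : Position V k) : ℝ :=
  ∑ v, ∑ i, pairWeight E R p v i

open scoped Classical in
/-- The danger of color `i` at the sets containing `w`. -/
noncomputable def colorPotential (E : V → Finset V) (R : ℝ) (p : Position V k) (w : V)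
    (i : Fin k) : ℝ :=
  ∑ v with w ∈ E v, pairWeight E R p v i

/-- The total danger at the sets containing `w`. -/
noncomputable def localPotential (E : V → Finset V) (R : ℝ) (p : Position V k) (w : V) : ℝ :=
  ∑ i, colorPotential E R p w i

theorem colorPotential_nonneg (E : V → Finset V) {R : ℝ} (hR : 1 ≤ R) (p : Position V k) (w : V)
    (i : Fin k) : 0 ≤ colorPotential E R p w i :=
  sum_nonneg fun v _ => pairWeight_nonneg E hR p v i

theorem localPotential_nonneg (E : V → Finset V) {R : ℝ} (hR : 1 ≤ R) (p : Position V k) (w : V) :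
    0 ≤ localPotential E R p w :=
  sum_nonneg fun i _ => colorPotential_nonneg E hR p w i

theorem colorPotential_play_le (E : V → Finset V) {R : ℝ} (hR : 1 ≤ R) {p : Position V k} {w : V}
    (hw : p w = none) (u : V) (i j : Fin k) :
    colorPotential E R (p.play w i) u j ≤ R * colorPotential E R p u j := by
  unfold colorPotential
  rw [mul_sum]
  exact sum_le_sum fun v _ => pairWeight_play_le hR hw v i j

theorem localPotential_play_le (E : V → Finset V) {R : ℝ} (hR : 1 ≤ R) {p : Position V k} {w : V}
    (hw : p w = none) (u : V) (i : Fin k) :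
    localPotential E R (p.play w i) u ≤ R * localPotential E R p u := by
  unfold localPotential
  rw [mul_sum]
  exact sum_le_sum fun j _ => colorPotential_play_le E hR hw u i j

/-- Coloring `w` affects only the sets containing `w`, so each move is accounted for locally. -/
theorem potential_play_sub (E : V → Finset V) (R : ℝ) (p : Position V k) (w : V) (i : Fin k) :
    potential E R (p.play w i) - potential E R p =
      localPotential E R (p.play w i) w - localPotential E R p w := by
  classical
  unfold potential localPotential colorPotential
  rw [sum_comm, sum_comm (s := univ) (t := univ) (f := fun v i => pairWeight E R p v i),
    ← sum_sub_distrib, ← sum_sub_distrib]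
  refine sum_congr rfl fun j _ => ?_
  rw [← sum_sub_distrib, ← sum_sub_distrib, sum_filter]
  refine sum_congr rfl fun v _ => ?_
  split_ifs with h
  · rfl
  · rw [pairWeight_play_of_notMem i j h, sub_self]

theorem localPotential_play_self_le (E : V → Finset V) {R : ℝ} (hR : 1 ≤ R) {p : Position V k}
    {w : V} (hw : p w = none) (i : Fin k) :
    localPotential E R (p.play w i) w ≤
      R * (localPotential E R p w - colorPotential E R p w i) := by
  classical
  unfold localPotential
  rw [← add_sum_erase _ _ (mem_univ i),
    ← add_sum_erase (f := fun j => colorPotential E R p w j) _ (mem_univ i), add_sub_cancel_left,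
    mul_sum]
  have h0 : colorPotential E R (p.play w i) w i = 0 :=
    sum_eq_zero fun v hv => pairWeight_play_eq_zero i (mem_filter.1 hv).2
  rw [h0, zero_add]
  exact sum_le_sum fun j _ => colorPotential_play_le E hR hw w i j

theorem exists_localPotential_le (hk : 1 ≤ k) (E : V → Finset V) (R : ℝ) (p : Position V k)
    (w : V) : ∃ i, localPotential E R p w ≤ k * colorPotential E R p w i := by
  obtain ⟨i, -, hi⟩ := exists_max_image (univ : Finset (Fin k)) (colorPotential E R p w)
    ⟨⟨0, hk⟩, mem_univ _⟩
  refine ⟨i, ?_⟩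
  simpa [localPotential] using sum_le_card_nsmul univ (colorPotential E R p w) _ hi

theorem potential_play_le (E : V → Finset V) {R : ℝ} (hR : 1 ≤ R) {p : Position V k} {w : V}
    (hw : p w = none) (i : Fin k) :
    potential E R (p.play w i) ≤ R * potential E R p := by
  unfold potential
  simp_rw [mul_sum]
  exact sum_le_sum fun v _ => sum_le_sum fun j _ => pairWeight_play_le hR hw v i j

/-- Alice has a move such that no reply of Bob makes the potential exceed its former value. -/
theorem exists_good_move (hk : 1 ≤ k) (E : V → Finset V) {p : Position V k}
    (hp : ∃ v, p v = none) :
    ∃ w i, p w = none ∧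
      potential E (1 + 1 / (2 * k)) (p.play w i) ≤ potential E (1 + 1 / (2 * k)) p ∧
      ∀ u j, p.play w i u = none →
        potential E (1 + 1 / (2 * k)) ((p.play w i).play u j) ≤
          potential E (1 + 1 / (2 * k)) p := by
  classical
  have hk' : (1 : ℝ) ≤ k := by exact_mod_cast hk
  -- Since `1 / k = 2 * s`, the best color at `w` carries at least `2 * s * L` of the local danger
  -- `L`.
  set s : ℝ := 1 / (2 * k) with hs
  have hs0 : 0 < s := by positivity
  have hR : 1 ≤ 1 + s := by linarith
  have hsk : s * k = 1 / 2 := by rw [hs]; field_simp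
  obtain ⟨v₀, hv₀⟩ := hp
  obtain ⟨w, hw, hmax⟩ := exists_max_image ({v | p v = none} : Finset V)
    (localPotential E (1 + s) p) ⟨v₀, by simpa using hv₀⟩
  have hw : p w = none := by simpa using hw
  obtain ⟨i, hi⟩ := exists_localPotential_le hk E (1 + s) p w
  set L := localPotential E (1 + s) p w with hL
  have hL0 : 0 ≤ L := localPotential_nonneg E hR p w
  have h₁ := potential_play_sub E (1 + s) p w i
  have h₂ : localPotential E (1 + s) (p.play w i) w ≤ (1 + s) * (L - 2 * s * L) := by
    refine (localPotential_play_self_le E hR hw i).trans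
      (mul_le_mul_of_nonneg_left (sub_le_sub_left ?_ _) (by linarith))
    have := mul_le_mul_of_nonneg_left hi hs0.le
    nlinarith
  -- The bound for Alice's move alone is needed when that move ends the game.
  refine ⟨w, i, hw, ?_, fun u j hu => ?_⟩
  · nlinarith [mul_nonneg hs0.le hL0, mul_nonneg hs0.le (mul_nonneg hs0.le hL0)]
  · have h₃ := potential_play_sub E (1 + s) (p.play w i) u j
    have h₄ := localPotential_play_le E hR hu u j
    have h₅ := localPotential_play_le E hR hw u i
    have hu' : p u = none := by
      by_cases e : u = w
      · rwa [e]
      · rwa [p.play_of_ne i e] at hu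
    have h₆ : localPotential E (1 + s) p u ≤ L := hmax u (by simpa using hu')
    have h₇ : s * localPotential E (1 + s) (p.play w i) u ≤ s * ((1 + s) * L) :=
      mul_le_mul_of_nonneg_left
        (h₅.trans (mul_le_mul_of_nonneg_left h₆ (by linarith))) hs0.le
    -- Alice gains at least `(s + 2 * s ^ 2) * L` and Bob regains at most `s * (1 + s) * L`, a net
    -- change of at most `-s ^ 2 * L`.
    nlinarith [mul_nonneg hs0.le (mul_nonneg hs0.le hL0)]

theorem one_le_potential_of_full {E : V → Finset V} {R : ℝ} (hR : 1 ≤ R) {p : Position V k}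
    (full : ∀ v, p v ≠ none) {v : V} {i : Fin k} (h : ¬ ∃ w ∈ E v, p w = some i) :
    1 ≤ potential E R p := by
  classical
  have h₁ : pairWeight E R p v i = 1 := by
    rw [pairWeight, if_neg h, filter_eq_empty_iff.2 fun w _ => full w, card_empty, pow_zero]
  rw [← h₁]
  refine (single_le_sum (f := fun i => pairWeight E R p v i)
    (fun j _ => pairWeight_nonneg E hR p v j) (mem_univ i)).trans ?_
  exact single_le_sum (f := fun v => ∑ i, pairWeight E R p v i)
    (fun u _ => sum_nonneg fun j _ => pairWeight_nonneg E hR p u j) (mem_univ v)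

theorem Position.ncard_play_lt {p : Position V k} {w : V} (hw : p w = none) (i : Fin k) :
    {v | p.play w i v = none}.ncard < {v | p v = none}.ncard := by
  refine Set.ncard_lt_ncard ⟨fun v hv => ?_, fun h => ?_⟩ (Set.toFinite _)
  · by_cases e : v = w
    · exact e ▸ hw
    · exact (p.play_of_ne i e).symm.trans hv
  · have : p.play w i w = none := h hw
    simp [p.play_self] at this

/-- Alice wins on her turn if the potential is below `1`. -/
theorem aliceWinsFrom_of_potential_lt_one (G : SimpleGraph V) (hk : 1 ≤ k) (E : V → Finset V)
    (hE : ∀ v, ∀ w ∈ E v, w = v ∨ G.Adj v w) (m : ℕ) :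
    ∀ p : Position V k, {v | p v = none}.ncard < m → potential E (1 + 1 / (2 * k)) p < 1 →
      AliceWinsFrom G k Player.alice p := by
  have hR : (1 : ℝ) ≤ 1 + 1 / (2 * k) := le_add_of_nonneg_right (by positivity)
  have fin : ∀ (X : Player) (p : Position V k), (∀ v, p v ≠ none) →
      potential E (1 + 1 / (2 * k)) p < 1 → AliceWinsFrom G k X p := by
    intro X p full hp
    refine .finished X p full fun i v => ?_
    by_contra hcon
    refine absurd (one_le_potential_of_full (i := i) (v := v) hR full ?_) (not_le.2 hp)
    rintro ⟨w, hw, hwi⟩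
    rcases hE v w hw with rfl | h
    · exact hcon (Or.inl hwi)
    · exact hcon (Or.inr ⟨w, hwi, h⟩)
  induction m with
  | zero => intro p h; omega
  | succ m ih =>
    intro p hm hp
    by_cases hex : ∃ v, p v = none
    · obtain ⟨w, i, hw, h₁, h₂⟩ := exists_good_move hk E hex
      refine .aliceMove p w i hw ?_
      by_cases hex' : ∃ v, p.play w i v = none
      · refine .bobMove _ hex' fun u j hu => ih _ ?_ ((h₂ u j hu).trans_lt hp)
        have a := Position.ncard_play_lt hw i
        have b := Position.ncard_play_lt hu j
        omega
      · exact fin _ _ (not_exists.1 hex') (h₁.trans_lt hp)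
    · exact fin _ _ (not_exists.1 hex) hp

theorem aliceWins_of_lt_pow [Nonempty V] (G : SimpleGraph V) [DecidableRel G.Adj] (hk : 1 ≤ k)
    (h : (Fintype.card V * k : ℝ) < (1 + 1 / (2 * k)) ^ G.minDegree) (X : Player) :
    AliceWins G X k := by
  classical
  set R : ℝ := 1 + 1 / (2 * k) with hRdef
  have hR : 1 ≤ R := le_add_of_nonneg_right (by positivity)
  have hR0 : 0 < R := by linarith
  let E : V → Finset V := fun v => insert v (G.neighborFinset v)
  have hE : ∀ v, ∀ w ∈ E v, w = v ∨ G.Adj v w := fun v w hw => by simpa [E] using hw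
  -- The factor `R` covers an opening move by Bob. It is absorbed by the closed neighborhoods having
  -- at least `δ + 1` elements.
  have hpot : R * potential E R (fun _ => none : Position V k) < 1 := by
    have hle : potential E R (fun _ => none : Position V k) ≤
        Fintype.card V * k * R⁻¹ ^ (G.minDegree + 1) := by
      have : ∀ v i, pairWeight E R (fun _ => none : Position V k) v i ≤
          R⁻¹ ^ (G.minDegree + 1) := fun v i => by
        rw [pairWeight, if_neg (by simp)]
        refine pow_le_pow_of_le_one (by positivity) (inv_le_one_of_one_le₀ hR) ?_
        simp only [filter_true, E]
        rw [card_insert_of_notMem (by simp), G.card_neighborFinset_eq_degree]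
        exact Nat.succ_le_succ (G.minDegree_le_degree v)
      calc potential E R (fun _ => none : Position V k)
          ≤ ∑ _v : V, ∑ _i : Fin k, R⁻¹ ^ (G.minDegree + 1) :=
            sum_le_sum fun v _ => sum_le_sum fun i _ => this v i
        _ = _ := by simp [mul_assoc]
    calc R * potential E R (fun _ => none : Position V k)
        ≤ R * (Fintype.card V * k * R⁻¹ ^ (G.minDegree + 1)) :=
          mul_le_mul_of_nonneg_left hle hR0.le
      _ = (Fintype.card V * k) / R ^ G.minDegree := by
          rw [pow_succ, inv_pow]; field_simp
      _ < 1 := (div_lt_one (by positivity)).2 h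
  have hnn : 0 ≤ potential E R (fun _ => none : Position V k) :=
    sum_nonneg fun v _ => sum_nonneg fun j _ => pairWeight_nonneg E hR _ v j
  have key := fun p => aliceWinsFrom_of_potential_lt_one G hk E hE _ p (Nat.lt_succ_self _)
  cases X with
  | alice => exact key _ (by nlinarith)
  | bob =>
    refine .bobMove _ ⟨Classical.arbitrary V, rfl⟩ fun v i hv => key _ ?_
    exact (potential_play_le E hR hv i).trans_lt hpot

end Potential

/-! ### The lower bound with constant `1 / 100` -/

theorem minDegree_div_log_le_domaticGameNumber {V : Type*} [Fintype V] (G : SimpleGraph V)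
    [DecidableRel G.Adj] (X : Player) (hn : 2 ≤ Fintype.card V) :
    (1 / 100 : ℝ) * ((G.minDegree : ℝ) / Real.log (Fintype.card V)) ≤ domaticGameNumber G X := by
  have hne : Nonempty V := Fintype.card_pos_iff.1 (by omega)
  have hgr := isGreatest_domaticGameNumber G X
  set n := Fintype.card V with hndef
  have hn' : (2 : ℝ) ≤ n := by exact_mod_cast hn
  have hlog : (1 / 2 : ℝ) ≤ Real.log n :=
    le_trans (by linarith [Real.log_two_gt_d9]) (Real.log_le_log (by norm_num) hn')
  set l := Real.log n with hl
  set x : ℝ := (1 / 100 : ℝ) * ((G.minDegree : ℝ) / l) with hx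
  have hδ : (G.minDegree : ℝ) = 100 * x * l := by rw [hx]; field_simp
  -- One color always works, so only `x > 1` matters; then `k = ⌈x⌉₊` satisfies `2 * k + 1 ≤ 6 * x`.
  rcases le_or_gt x 1 with h1 | h1
  · exact h1.trans (by exact_mod_cast hgr.1.1)
  have hdn : G.minDegree < n :=
    (G.minDegree_le_degree (Classical.arbitrary V)).trans_lt (G.degree_lt_card_verts _)
  have hk1 : 1 ≤ ⌈x⌉₊ := Nat.one_le_ceil_iff.2 (by linarith)
  have hk2 : (⌈x⌉₊ : ℝ) < x + 1 := Nat.ceil_lt_add_one (by linarith)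
  have hk3 : x ≤ ⌈x⌉₊ := Nat.le_ceil x
  set k := ⌈x⌉₊ with hk
  have hkpos : (0 : ℝ) < k := by linarith
  refine hk3.trans (Nat.cast_le.2 (hgr.2 ⟨hk1, aliceWins_of_lt_pow G hk1 ?_ X⟩))
  have hkn : (k : ℝ) ≤ n := by
    have : (G.minDegree : ℝ) < n := by exact_mod_cast hdn
    nlinarith
  have hR0 : (0 : ℝ) < 1 + 1 / (2 * k) := by positivity
  rw [← Real.log_lt_log_iff (by positivity) (by positivity), Real.log_pow,
    Real.log_mul (by positivity) (by positivity)]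
  have hlk : Real.log k ≤ l := Real.log_le_log hkpos hkn
  have hR : 1 / (2 * k + 1) ≤ Real.log (1 + 1 / (2 * k) : ℝ) := by
    refine le_trans (le_of_eq ?_) (Real.one_sub_inv_le_log_of_pos hR0)
    field_simp
    ring
  have h6 : 1 / (6 * x) ≤ (1 / (2 * k + 1) : ℝ) :=
    one_div_le_one_div_of_le (by positivity) (by linarith)
  have hxl : 0 < x := by linarith
  calc Real.log n + Real.log k ≤ 2 * l := by linarith
    _ < 100 / 6 * l := by linarith
    _ = (G.minDegree : ℝ) * (1 / (6 * x)) := by rw [hδ]; field_simp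
    _ ≤ _ := mul_le_mul_of_nonneg_left (h6.trans hR) (Nat.cast_nonneg _)

/-! ### Bob's pairing strategy -/

section Pairing

variable {V ι : Type*} {k : ℕ}

/-- The pair `a j, b j` contains a vertex of color `c` or is untouched. -/
def PairSafe (a b : ι → V) (c : Fin k) (p : Position V k) (j : ι) : Prop :=
  p (a j) = some c ∨ p (b j) = some c ∨ p (a j) = none ∧ p (b j) = none

/-- Playing `c` anywhere never hurts Bob, so being forced to move is harmless when no pair needs a
reply. -/
theorem PairSafe.play_color {a b : ι → V} {c : Fin k} {p : Position V k} {j : ι}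
    (h : PairSafe a b c p j) (v : V) : PairSafe a b c (p.play v c) j := by
  unfold PairSafe Position.play at *
  by_cases h₁ : a j = v <;> by_cases h₂ : b j = v <;> simp_all

theorem pairSafe_play_iff {a b : ι → V} {c i : Fin k} {p : Position V k} {j : ι} {v : V}
    (ha : a j ≠ v) (hb : b j ≠ v) : PairSafe a b c (p.play v i) j ↔ PairSafe a b c p j := by
  unfold PairSafe
  rw [p.play_of_ne i ha, p.play_of_ne i hb]

/-- Bob wins by a pairing strategy if obtaining color `c` in each of the disjoint pairs
`a j, b j` prevents the color classes from being dominating. -/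
theorem not_aliceWins_of_pairing {G : SimpleGraph V} {a b : ι → V} (ha : a.Injective)
    (hb : b.Injective) (hab : ∀ i j, a i ≠ b j) (c : Fin k)
    (hwin : ∀ q : Position V k, (∀ j, q (a j) = some c ∨ q (b j) = some c) →
      ¬ ∀ i : Fin k, IsDominating G {v | q v = some i}) (X : Player) : ¬ AliceWins G X k := by
  -- Invariant: all pairs are safe, except that on Bob's turn one pair may be unsafe if it still has
  -- an uncolored vertex to receive `c`.
  have key : ∀ (X : Player) (p : Position V k), AliceWinsFrom G k X p →
      ¬ ((∀ j, PairSafe a b c p j) ∨ X = Player.bob ∧ ∃ j₀,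
        (p (a j₀) = none ∨ p (b j₀) = none) ∧ ∀ j, j ≠ j₀ → PairSafe a b c p j) := by
    intro X p h
    induction h with
    | finished X p full dom =>
      rintro (h | ⟨-, j₀, h, -⟩)
      · exact hwin p (fun j => by simpa [PairSafe, full] using h j) dom
      · simp [full] at h
    | aliceMove p v i hv next ih =>
      rintro (h | ⟨h, -⟩)
      swap
      · cases h
      apply ih
      by_cases hva : ∃ j₀, a j₀ = v ∨ b j₀ = v
      · obtain ⟨j₀, hj₀⟩ := hva
        have hother : ∀ j, j ≠ j₀ → PairSafe a b c (p.play v i) j := fun j hj => by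
          refine (pairSafe_play_iff ?_ ?_).2 (h j)
          · rcases hj₀ with rfl | rfl
            · exact fun e => hj (ha e)
            · exact hab _ _
          · rcases hj₀ with rfl | rfl
            · exact (hab _ _).symm
            · exact fun e => hj (hb e)
        have hj := h j₀
        rcases hj₀ with rfl | rfl
        · have e := p.play_of_ne i (hab j₀ j₀).symm
          rcases hj with hj | hj | hj
          · simp [hv] at hj
          · refine Or.inl fun j => ?_
            by_cases hjj : j = j₀
            · subst hjj
              exact Or.inr (Or.inl (e.trans hj))
            · exact hother j hjj
          · exact Or.inr ⟨rfl, j₀, Or.inr (e.trans hj.2), hother⟩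
        · have e := p.play_of_ne i (hab j₀ j₀)
          rcases hj with hj | hj | hj
          · refine Or.inl fun j => ?_
            by_cases hjj : j = j₀
            · subst hjj
              exact Or.inl (e.trans hj)
            · exact hother j hjj
          · simp [hv] at hj
          · exact Or.inr ⟨rfl, j₀, Or.inl (e.trans hj.1), hother⟩
      · push Not at hva
        exact Or.inl fun j => (pairSafe_play_iff (hva j).1 (hva j).2).2 (h j)
    | bobMove p unfinished next ih =>
      rintro (h | ⟨-, j₀, h₀, h⟩)
      · obtain ⟨v, hv⟩ := unfinished
        exact ih v c hv (Or.inl fun j => (h j).play_color v)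
      · rcases h₀ with h₀ | h₀
        · refine ih _ c h₀ (Or.inl fun j => ?_)
          by_cases hj : j = j₀
          · exact Or.inl (hj ▸ p.play_self _ c)
          · exact (h j hj).play_color _
        · refine ih _ c h₀ (Or.inl fun j => ?_)
          by_cases hj : j = j₀
          · exact Or.inr (Or.inl (hj ▸ p.play_self _ c))
          · exact (h j hj).play_color _
  exact fun h => key X _ h (Or.inl fun j => Or.inr (Or.inr ⟨rfl, rfl⟩))

end Pairing

/-! ### The digit graph and its degrees -/

/-- The bipartite graph on `Fin n` with parts `[0, 2t)` and `[2t, n)` in which `2i + b` with `i < t`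
is adjacent to `2(t + F)` and `2(t + F) + 1` if and only if `b` is the `i`-th binary digit of
`F`. -/
def digitGraph (n t : ℕ) : SimpleGraph (Fin n) :=
  SimpleGraph.fromRel fun x y : Fin n =>
    x.1 < 2 * t ∧ 2 * t ≤ y.1 ∧ (y.1 / 2 - t).testBit (x.1 / 2) = decide (x.1 % 2 = 1)

theorem digitGraph_adj_of_le {n t : ℕ} {x y : Fin n} (hy : 2 * t ≤ y.1) :
    (digitGraph n t).Adj y x ↔
      x.1 < 2 * t ∧ (y.1 / 2 - t).testBit (x.1 / 2) = decide (x.1 % 2 = 1) := by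
  simp only [digitGraph, SimpleGraph.fromRel_adj, ne_eq, Fin.ext_iff]
  constructor
  · rintro ⟨-, h | h⟩
    · omega
    · exact ⟨h.1, h.2.2⟩
  · exact fun h => ⟨by omega, Or.inr ⟨h.1, hy, h.2⟩⟩

theorem digitGraph_adj_lt_iff {n t : ℕ} {x y : Fin n} (h : (digitGraph n t).Adj x y) :
    x.1 < 2 * t ↔ ¬ y.1 < 2 * t := by
  simp only [digitGraph, SimpleGraph.fromRel_adj] at h
  omega

theorem digitGraph_isBipartite (n t : ℕ) : (digitGraph n t).IsBipartite := by
  refine ⟨SimpleGraph.Coloring.mk (fun x => if x.1 < 2 * t then 0 else 1) fun {x y} h => ?_⟩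
  have := digitGraph_adj_lt_iff h
  by_cases hx : x.1 < 2 * t <;> by_cases hy : y.1 < 2 * t <;> simp_all

theorem not_aliceWins_digitGraph {n t k : ℕ} (hn : 2 * t + 2 * 2 ^ t ≤ n) (hk : 2 ≤ k)
    (X : Player) : ¬ AliceWins (digitGraph n t) X k := by
  refine not_aliceWins_of_pairing (ι := Fin (n / 2)) (a := fun j => ⟨2 * j, by omega⟩)
    (b := fun j => ⟨2 * j + 1, by omega⟩) (fun i j h => ?_) (fun i j h => ?_) (fun i j h => ?_)
    (⟨0, by omega⟩ : Fin k) (fun q hq hdom => ?_) X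
  · simp only [Fin.mk.injEq] at h
    exact Fin.ext (by omega)
  · simp only [Fin.mk.injEq] at h
    exact Fin.ext (by omega)
  · simp only [Fin.mk.injEq] at h
    omega
  · have hpair : ∀ m, m < n / 2 → ∃ v : Fin n, v.1 / 2 = m ∧ q v = some ⟨0, by omega⟩ := by
      intro m hm
      rcases hq ⟨m, hm⟩ with h | h
      · exact ⟨_, by simp, h⟩
      · exact ⟨_, by simp only; omega, h⟩
    choose f hf hqf using fun j : Fin t => hpair j (by have := j.2; omega)
    -- `F` is spelled by Bob's choices in the digit pairs, so every neighbor of the vertex `y` below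
    -- has color `0`, as does `y` itself: color `1` fails to dominate `y`.
    set F := Nat.ofBits fun j : Fin t => decide ((f j).1 % 2 = 1) with hF
    have hFlt : F < 2 ^ t := Nat.ofBits_lt_two_pow _
    obtain ⟨y, hy, hqy⟩ := hpair (t + F) (by omega)
    have hy2 : 2 * t ≤ y.1 := by omega
    rcases hdom ⟨1, by omega⟩ y with h | ⟨w, h, hadj⟩
    · simp [hqy] at h
    · rw [digitGraph_adj_of_le hy2, show y.1 / 2 - t = F by omega] at hadj
      have hwt : w.1 / 2 < t := by omega
      have hbit := hadj.2
      rw [hF, Nat.testBit_ofBits_lt _ _ hwt, decide_eq_decide] at hbit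
      have hfw := hf ⟨w.1 / 2, hwt⟩
      have e : f ⟨w.1 / 2, hwt⟩ = w := Fin.ext (by simp only at hfw; omega)
      have := hqf ⟨w.1 / 2, hwt⟩
      rw [e] at this
      simp [this] at h

theorem minDegree_digitGraph_le {n t : ℕ} (hn : 2 * t < n) [DecidableRel (digitGraph n t).Adj] :
    (digitGraph n t).minDegree ≤ 2 * t := by
  classical
  refine ((digitGraph n t).minDegree_le_degree ⟨2 * t, hn⟩).trans ?_
  rw [← SimpleGraph.card_neighborFinset_eq_degree]
  have := card_le_card_of_injOn (s := (digitGraph n t).neighborFinset ⟨2 * t, hn⟩)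
    (t := range (2 * t)) Fin.val (fun x hx => ?_) Fin.val_injective.injOn
  · simpa using this
  · rw [SimpleGraph.coe_neighborFinset, SimpleGraph.mem_neighborSet,
      digitGraph_adj_of_le le_rfl] at hx
    simpa using hx.1

theorem le_degree_of_injective {V : Type*} [Fintype V] (G : SimpleGraph V) [DecidableRel G.Adj]
    {t : ℕ} (v : V) (f : Fin t → V) (hf : f.Injective) (h : ∀ j, G.Adj v (f j)) :
    t ≤ G.degree v := by
  rw [← SimpleGraph.card_neighborFinset_eq_degree]
  simpa using card_le_card_of_injOn (s := univ) (t := G.neighborFinset v) f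
    (fun j _ => by simpa using h j) hf.injOn

theorem le_minDegree_digitGraph {n t : ℕ} (hn : 2 * t + 2 * 2 ^ t ≤ n)
    [DecidableRel (digitGraph n t).Adj] : t ≤ (digitGraph n t).minDegree := by
  have h2 : 0 < 2 ^ t := by positivity
  have : Nonempty (Fin n) := ⟨⟨0, by omega⟩⟩
  refine SimpleGraph.le_minDegree_of_forall_le_degree _ _ fun v => ?_
  rcases le_or_gt (2 * t) v.1 with hv | hv
  · refine le_degree_of_injective _ v (fun j : Fin t =>
      ⟨2 * j + ((v.1 / 2 - t).testBit j).toNat, ?_⟩) (fun i j h => ?_) fun j => ?_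
    · have := Bool.toNat_le ((v.1 / 2 - t).testBit j)
      omega
    · have hi := Bool.toNat_le ((v.1 / 2 - t).testBit i)
      have hj := Bool.toNat_le ((v.1 / 2 - t).testBit j)
      simp only [Fin.mk.injEq] at h
      exact Fin.ext (by omega)
    · rw [digitGraph_adj_of_le hv]
      have hj := j.2
      have hdigit : ∀ b : Bool, (2 * j.1 + b.toNat) / 2 = j.1 ∧
          decide ((2 * j.1 + b.toNat) % 2 = 1) = b := by
        rintro (_ | _)
        · simp
        · exact ⟨by simp only [Bool.toNat_true]; omega, by simp⟩
      have hb := Bool.toNat_le ((v.1 / 2 - t).testBit j)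
      exact ⟨by simp only; omega,
        (congrArg _ (hdigit _).1).trans (hdigit _).2.symm⟩
  · have hvt : v.1 / 2 < t := by omega
    -- Digit `v / 2` must have the value selecting `v`; the remaining digits form the indicator of
    -- `j`, which vanishes for `j = v / 2`. These are `t` distinct strings.
    let g : Fin t → Fin t → Bool := fun j l =>
      if l.1 = v.1 / 2 then decide (v.1 % 2 = 1) else decide (l = j)
    have hg : ∀ j, Nat.ofBits (g j) < 2 ^ t := fun j => Nat.ofBits_lt_two_pow _
    refine le_degree_of_injective _ v (fun j => ⟨2 * (t + Nat.ofBits (g j)), ?_⟩)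
      (fun i j h => ?_) fun j => ?_
    · have := hg j
      omega
    · simp only [Fin.mk.injEq] at h
      have hb : ∀ l, g i l = g j l := fun l => by
        rw [← Nat.testBit_ofBits_lt (g i) l l.2, ← Nat.testBit_ofBits_lt (g j) l l.2,
          show Nat.ofBits (g i) = Nat.ofBits (g j) by omega]
      by_contra hij
      by_cases hi : i.1 = v.1 / 2
      · have hj : j.1 ≠ v.1 / 2 := fun e => hij (Fin.ext (hi.trans e.symm))
        have := hb j
        simp [g, hj, Ne.symm hij] at this
      · have := hb i
        simp [g, hi, hij] at this
    · rw [SimpleGraph.adj_comm, digitGraph_adj_of_le (by simp only; omega)]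
      refine ⟨hv, ?_⟩
      simp only
      rw [show 2 * (t + Nat.ofBits (g j)) / 2 - t = Nat.ofBits (g j) by omega,
        Nat.testBit_ofBits_lt _ _ hvt]
      simp [g]

/-! ### The choice of `t` and the asymptotics -/

theorem domaticGameNumber_eq_one {V : Type*} [Fintype V] [Nonempty V] (G : SimpleGraph V)
    (X : Player) (h : ∀ k, 2 ≤ k → ¬ AliceWins G X k) : domaticGameNumber G X = 1 := by
  have hgr := isGreatest_domaticGameNumber G X
  refine le_antisymm ?_ hgr.1.1
  by_contra hlt
  exact h _ (by omega) hgr.1.2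

theorem two_mul_add_two_pow_log_le {n : ℕ} (hn : 2 ≤ n) :
    2 * (Nat.log 2 n - 2) + 2 * 2 ^ (Nat.log 2 n - 2) ≤ n := by
  have h₁ : 2 ^ Nat.log 2 n ≤ n := Nat.pow_log_le_self 2 (by omega)
  rcases lt_or_ge (Nat.log 2 n) 2 with h | h
  · rw [Nat.sub_eq_zero_of_le h.le]
    simpa using hn
  · obtain ⟨t, ht⟩ := Nat.exists_eq_add_of_le' h
    rw [ht] at h₁ ⊢
    have := (Nat.lt_two_pow_self (n := t)).le
    rw [pow_add] at h₁
    simp only [Nat.add_sub_cancel]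
    omega

theorem minDegree_digitGraph_isTheta_log
    (inst : ∀ n, DecidableRel (digitGraph n (Nat.log 2 n - 2)).Adj) :
    (fun n : ℕ => ((digitGraph n (Nat.log 2 n - 2)).minDegree : ℝ)) =Θ[atTop]
      fun n : ℕ => Real.log (n : ℝ) := by
  have main : ∀ n : ℕ, 8 ≤ n →
      ((digitGraph n (Nat.log 2 n - 2)).minDegree : ℝ) ≤ 4 * Real.log n ∧
      Real.log n ≤ 4 * ((digitGraph n (Nat.log 2 n - 2)).minDegree : ℝ) := by
    intro n hn
    have hlt := two_mul_add_two_pow_log_le (n := n) (by omega)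
    have hpos : 0 < 2 ^ (Nat.log 2 n - 2) := by positivity
    have hup := minDegree_digitGraph_le (n := n) (t := Nat.log 2 n - 2) (by omega)
    have hlo := le_minDegree_digitGraph hlt
    -- From `L ≥ 3` follows `L + 1 ≤ 4 * (L - 2)`, the source of the threshold `8` and of the factor
    -- `4` in the lower degree bound.
    have hL : 3 ≤ Nat.log 2 n := Nat.le_log_of_pow_le (by norm_num) (by omega)
    have h₁ : 2 ^ Nat.log 2 n ≤ n := Nat.pow_log_le_self 2 (by omega)
    have h₂ : n < 2 ^ (Nat.log 2 n + 1) := Nat.lt_pow_succ_log_self (by norm_num) n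
    set L := Nat.log 2 n
    set d := (digitGraph n (L - 2)).minDegree
    have h₁' : L * Real.log 2 ≤ Real.log n := by
      rw [← Real.log_pow]
      exact Real.log_le_log (by positivity) (by exact_mod_cast h₁)
    have h₂' : Real.log n ≤ (L + 1) * Real.log 2 := by
      have : Real.log n ≤ Real.log ((2 : ℝ) ^ (L + 1)) :=
        Real.log_le_log (by positivity) (by exact_mod_cast h₂.le)
      rw [Real.log_pow] at this
      exact_mod_cast this
    have hup' : (d : ℝ) ≤ 2 * L := by exact_mod_cast (by omega : d ≤ 2 * L)
    have hlo' : (L : ℝ) + 1 ≤ 4 * d := by exact_mod_cast (by omega : L + 1 ≤ 4 * d)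
    have ha := Real.log_two_gt_d9
    have hb := Real.log_two_lt_d9
    have hL0 : (0 : ℝ) ≤ L := Nat.cast_nonneg L
    constructor <;> nlinarith
  constructor
  · refine IsBigO.of_bound 4 (eventually_atTop.2 ⟨8, fun n hn => ?_⟩)
    have := (main n hn).1
    rw [Real.norm_of_nonneg (Nat.cast_nonneg _), Real.norm_of_nonneg (Real.log_natCast_nonneg n)]
    exact this
  · refine IsBigO.of_bound 4 (eventually_atTop.2 ⟨8, fun n hn => ?_⟩)
    have := (main n hn).2
    rw [Real.norm_of_nonneg (Nat.cast_nonneg _), Real.norm_of_nonneg (Real.log_natCast_nonneg n)]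
    exact this

theorem domaticGameNumber_digitGraph {n : ℕ} (hn : 1 ≤ n) (X : Player) :
    domaticGameNumber (digitGraph n (Nat.log 2 n - 2)) X = 1 := by
  have : Nonempty (Fin n) := ⟨⟨0, hn⟩⟩
  refine domaticGameNumber_eq_one _ X fun k hk hwin => ?_
  -- A single vertex is too small to hold the construction, but it admits only one color.
  rcases hn.eq_or_lt with rfl | hn
  · have := hwin.le_card (by omega)
    rw [Fintype.card_fin] at this
    omega
  · exact not_aliceWins_digitGraph (two_mul_add_two_pow_log_le hn) hk X hwin

end DomaticGame

theorem mainTheorem1 :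
    -- a uniform constant works for all graphs on at least two vertices
    (∃ c : ℝ, 0 < c ∧
      ∀ (V : Type u) [Fintype V] (G : SimpleGraph V) [DecidableRel G.Adj] (X : DomaticGame.Player),
        2 ≤ Fintype.card V →
        c * ((G.minDegree : ℝ) / Real.log (Fintype.card V))
          ≤ (DomaticGame.domaticGameNumber G X : ℝ)) ∧
    -- the constant `1 / 100` works for all sufficiently large graphs
    (∃ n₀ : ℕ,
      ∀ (V : Type u) [Fintype V] (G : SimpleGraph V) [DecidableRel G.Adj] (X : DomaticGame.Player),
        2 ≤ Fintype.card V → n₀ ≤ Fintype.card V →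
        (1 / 100 : ℝ) * ((G.minDegree : ℝ) / Real.log (Fintype.card V))
          ≤ (DomaticGame.domaticGameNumber G X : ℝ)) ∧
    -- graphs of logarithmic minimum degree with domatic game number `1`
    (∃ (G : (n : ℕ) → SimpleGraph (Fin n)) (_ : (n : ℕ) → DecidableRel (G n).Adj),
      (∀ n : ℕ, 1 ≤ n → (G n).IsBipartite ∧
        ∀ X : DomaticGame.Player, DomaticGame.domaticGameNumber (G n) X = 1) ∧
      (fun n : ℕ => ((G n).minDegree : ℝ)) =Θ[atTop] (fun n : ℕ => Real.log (n : ℝ))) := by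
  refine ⟨⟨1 / 100, by norm_num, fun V _ G _ X hn =>
      DomaticGame.minDegree_div_log_le_domaticGameNumber G X hn⟩,
    ⟨0, fun V _ G _ X hn _ => DomaticGame.minDegree_div_log_le_domaticGameNumber G X hn⟩,
    fun n => DomaticGame.digitGraph n (Nat.log 2 n - 2), fun n => Classical.decRel _,
    fun n hn => ⟨DomaticGame.digitGraph_isBipartite n _, fun X =>
      DomaticGame.domaticGameNumber_digitGraph hn X⟩,
    DomaticGame.minDegree_digitGraph_isTheta_log _⟩
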